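/- Let $k\ge 1$ be an integer, $d_k=k+1$, $\gamma\in\mathbb R$, $\rho=\gamma(k+2)$ and $\lambda_h>0$. Let $\mathcal H_{(k,\rho)}$ be the Hilbert space of the principal series unitary representation $D^{(k,\rho)}$ of $\mathrm{SL}(2,\mathbb C)$: it consists of the (classes of measurable) functions $F$ on $\mathbb C^2\setminus\{0\}$ with $F(tz)=t^{\,i\rho/2-1+k/2}\,\bar t^{\,i\rho/2-1-k/2}F(z)$ for $t\in\mathbb C\setminus\{0\}$ and $\int_{\mathbb C}|F(z,1)|^2\,d^2z<\infty$ (this integral being the squared norm), on which $g$ acts by $(D^{(k,\rho)}(g)F)(z_1,z_2)=F((z_1,z_2)g)$. Let $\mathcal H_k\subset\mathcal H_{(k,\rho)}$ be the $d_k$-dimensional subspace carrying the spin-$k/2$ representation of $\mathrm{SU}(2)$, i.e. the space of the functions $(|z_1|^2+|z_2|^2)^{i\rho/2-1-k/2}\,p(z_1,z_2)$ with $p$ a homogeneous polynomial of degree $k$, and let $P_k$ be the orthogonal projection of $\mathcal H_{(k,\rho)}$ onto $\mathcal H_k$. Let $h$ be an internal face whose oriented boundary $\partial h$ is a closed path through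 $n\ge 1$ vertices $v$. For each such $v$ let $e$ and $e'$ be the edges of $\partial h$ that enter and leave $v$, and let $g_{ve},g_{ve'}\in\mathrm{SL}(2,\mathbb C)$ be arbitrary. Put $$\zeta_k^{(h)}=\lambda_h\,d_k\,\mathrm{Tr}_{\mathcal H_{(k,\rho)}}\Big[\overrightarrow{\prod_{v\in\partial h}}P_k\,D^{(k,\rho)}(g_{ve}^{-1}g_{ve'})\,P_k\Big],$$ where the product is ordered along $\partial h$. Then $$|\zeta_k^{(h)}|\le\lambda_h d_k^2,$$ and equality holds if and only if $g_{ve}^{-1}g_{ve'}\in\mathrm{SU}(2)$ for every vertex $v$ of $\partial h$ and $\overrightarrow{\prod}_{v\in\partial h}\,g_{ve}^{-1}g_{ve'}=\pm 1$. -/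

import Mathlib

open MeasureTheory Complex
open scoped ENNReal InnerProductSpace MatrixGroups

noncomputable section

namespace Spinfoam

/-! ### The principal series of `SL(2, ℂ)`

The representation `(k, ρ)` acts on functions `F` on `ℂ² ∖ {0}` with
`F (t z₁, t z₂) = t ^ (iρ/2 - 1 + k/2) * conj t ^ (iρ/2 - 1 - k/2) * F (z₁, z₂)` by
`(g F) (z₁, z₂) = F ((z₁, z₂) g)` (row vector times matrix), with squared norm the integral of
`|F|²` over the projective line.  In the affine chart `f z = F (z, 1)` this is `L²(ℂ)` for Lebesgue
measure, with `(g f) z = χ (b z + d) * f ((a z + c) / (b z + d))` for `g = !![a, b; c, d]`, where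
`χ w = w ^ (iρ/2 - 1 + k/2) * conj w ^ (iρ/2 - 1 - k/2) = |w| ^ (iρ - 2 - k) * w ^ k`. -/

/-- The Hilbert space `L²(ℂ)` carrying the principal series representations. -/
abbrev PSpace : Type := Lp ℂ 2 (volume : Measure ℂ)

/-- The second component `b z + d` of `(z, 1) g`. -/
def den (g : SL(2, ℂ)) (z : ℂ) : ℂ := g 0 1 * z + g 1 1

/-- The Möbius map `z ↦ (a z + c) / (b z + d)`, i.e. the action of `g` on `[z : 1]`. -/
def mob (g : SL(2, ℂ)) (z : ℂ) : ℂ := (g 0 0 * z + g 1 0) / den g z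

/-- The homogeneity character `χ w = |w| ^ (iρ - 2 - k) * w ^ k`. -/
def chi (k : ℕ) (ρ : ℝ) (w : ℂ) : ℂ := (‖w‖ : ℂ) ^ (I * ρ - 2 - k) * w ^ k

/-- The principal series action on functions on `ℂ`. -/
def actFun (k : ℕ) (ρ : ℝ) (g : SL(2, ℂ)) (f : ℂ → ℂ) (z : ℂ) : ℂ :=
  chi k ρ (den g z) * f (mob g z)

theorem det_eq (g : SL(2, ℂ)) : g 0 0 * g 1 1 - g 0 1 * g 1 0 = 1 := by
  have := g.det_coe
  rwa [Matrix.det_fin_two] at this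

theorem null_affine (p q : ℂ) (h : p ≠ 0 ∨ q ≠ 0) : volume {z : ℂ | p * z + q = 0} = 0 := by
  refine Set.Subsingleton.measure_zero (fun x hx y hy => ?_) _
  simp only [Set.mem_ofPred_eq] at hx hy
  rcases eq_or_ne p 0 with rfl | hp
  · simp_all
  · exact mul_left_cancel₀ hp (by linear_combination hx - hy)

theorem ae_den_ne_zero (g : SL(2, ℂ)) : ∀ᵐ z : ℂ, den g z ≠ 0 := by
  have h : volume {z : ℂ | den g z = 0} = 0 := by
    refine null_affine (g 0 1) (g 1 1) ?_
    by_contra! h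
    have := det_eq g
    simp [h.1, h.2] at this
  simpa [ae_iff] using h

theorem norm_chi (k : ℕ) (ρ : ℝ) {w : ℂ} (hw : w ≠ 0) : ‖chi k ρ w‖ = (‖w‖ ^ 2)⁻¹ := by
  have h : 0 < ‖w‖ := norm_pos_iff.mpr hw
  rw [chi, norm_mul, norm_cpow_eq_rpow_re_of_pos h, norm_pow, ← Real.rpow_natCast ‖w‖ k,
    ← Real.rpow_add h]
  have : (I * (ρ : ℂ) - 2 - k).re + (k : ℝ) = -(2 : ℕ) := by simp
  rw [this, Real.rpow_neg h.le, Real.rpow_natCast]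

theorem chi_mul (k : ℕ) (ρ : ℝ) (v w : ℂ) : chi k ρ (v * w) = chi k ρ v * chi k ρ w := by
  simp only [chi, norm_mul, ofReal_mul, mul_pow]
  rw [mul_cpow_ofReal_nonneg (norm_nonneg _) (norm_nonneg _)]
  ring

theorem den_mul (g h : SL(2, ℂ)) {z : ℂ} (hz : den g z ≠ 0) :
    den (g * h) z = den g z * den h (mob g z) := by
  have e : den g z * mob g z = g 0 0 * z + g 1 0 := by rw [mob, mul_div_cancel₀ _ hz]
  have : den g z * den h (mob g z) = h 0 1 * (den g z * mob g z) + h 1 1 * den g z := by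
    simp only [den]; ring
  rw [this, e]
  simp only [den, Matrix.SpecialLinearGroup.coe_mul, Matrix.mul_apply, Fin.sum_univ_two]
  ring

theorem mob_mul (g h : SL(2, ℂ)) {z : ℂ} (hz : den g z ≠ 0) :
    mob (g * h) z = mob h (mob g z) := by
  have e : den g z * mob g z = g 0 0 * z + g 1 0 := by rw [mob, mul_div_cancel₀ _ hz]
  have e' : mob h (mob g z) = (h 0 0 * mob g z + h 1 0) / den h (mob g z) := rfl
  rw [e', ← mul_div_mul_left _ (den h (mob g z)) hz, ← den_mul g h hz, mob]
  congr 1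
  have : den g z * (h 0 0 * mob g z + h 1 0) = h 0 0 * (den g z * mob g z) + h 1 0 * den g z := by
    ring
  rw [this, e]
  simp only [den, Matrix.SpecialLinearGroup.coe_mul, Matrix.mul_apply, Fin.sum_univ_two]
  ring

theorem measurable_den (g : SL(2, ℂ)) : Measurable (den g) := by
  unfold den; fun_prop

theorem measurable_mob (g : SL(2, ℂ)) : Measurable (mob g) := by
  unfold mob den; fun_prop

theorem measurable_chi (k : ℕ) (ρ : ℝ) : Measurable (chi k ρ) := by
  unfold chi; fun_prop

theorem hasDerivAt_mob (g : SL(2, ℂ)) {z : ℂ} (hz : den g z ≠ 0) :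
    HasDerivAt (mob g) (1 / den g z ^ 2) z := by
  have h1 : HasDerivAt (fun z : ℂ => g 0 0 * z + g 1 0) (g 0 0) z := by
    simpa using ((hasDerivAt_id z).const_mul (g 0 0)).add_const (g 1 0)
  have h2 : HasDerivAt (den g) (g 0 1) z := by
    have : HasDerivAt (fun z : ℂ => g 0 1 * z + g 1 1) (g 0 1) z := by
      simpa using ((hasDerivAt_id z).const_mul (g 0 1)).add_const (g 1 1)
    exact this
  have e : 1 / den g z ^ 2 =
      (g 0 0 * den g z - (g 0 0 * z + g 1 0) * g 0 1) / den g z ^ 2 := by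
    congr 1
    rw [show den g z = g 0 1 * z + g 1 1 from rfl]
    linear_combination -det_eq g
  rw [e]
  exact h1.div h2 hz

theorem injOn_mob (g : SL(2, ℂ)) : Set.InjOn (mob g) {z | den g z ≠ 0} := by
  intro x hx y hy h
  have h1 : den g⁻¹ (mob g x) ≠ 0 := by
    intro h0
    have := den_mul g g⁻¹ hx
    rw [h0] at this
    simp [den] at this
  have key : ∀ z, den g z ≠ 0 → mob g⁻¹ (mob g z) = z := by
    intro z hz
    rw [← mob_mul g g⁻¹ hz]
    simp [mob, den]
  rw [← key x hx, ← key y hy, h]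

theorem det_restrictScalars (w : ℂ) :
    ((ContinuousLinearMap.toSpanSingleton ℂ w).restrictScalars ℝ : ℂ →L[ℝ] ℂ).det = ‖w‖ ^ 2 := by
  have : (((ContinuousLinearMap.toSpanSingleton ℂ w).restrictScalars ℝ : ℂ →L[ℝ] ℂ) :
      ℂ →ₗ[ℝ] ℂ) = Algebra.lmul ℝ ℂ w := by
    ext z; simp [mul_comm]
  rw [ContinuousLinearMap.det, this, ← Algebra.norm_apply, Algebra.norm_complex_apply,
    normSq_eq_norm_sq]

/-- Change of variables along a Möbius map. -/
theorem lintegral_mob (g : SL(2, ℂ)) (F : ℂ → ℝ≥0∞) :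
    ∫⁻ z, ENNReal.ofReal (‖1 / den g z ^ 2‖ ^ 2) * F (mob g z) = ∫⁻ z, F z := by
  have hs : MeasurableSet {z | den g z ≠ 0} := (measurable_den g) (measurableSet_singleton 0).compl
  have h := lintegral_image_eq_lintegral_abs_det_fderiv_mul volume hs (f := mob g)
    (f' := fun z => (ContinuousLinearMap.toSpanSingleton ℂ (1 / den g z ^ 2)).restrictScalars ℝ)
    (fun z hz => ((hasDerivAt_mob g hz).hasFDerivAt.restrictScalars ℝ).hasFDerivWithinAt)
    (injOn_mob g) F
  simp only [det_restrictScalars, abs_pow, abs_norm] at h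
  rw [setLIntegral_congr (t := Set.univ), setLIntegral_univ] at h
  · rw [h, setLIntegral_congr (t := Set.univ), setLIntegral_univ]
    exact Filter.eventuallyEq_univ.mpr (ae_den_ne_zero g)
  · refine Filter.eventuallyEq_univ.mpr ?_
    filter_upwards [ae_den_ne_zero g⁻¹] with w hw
    refine ⟨mob g⁻¹ w, ?_, ?_⟩
    · intro h0
      have := den_mul g⁻¹ g hw
      rw [h0] at this
      simp [den] at this
    · rw [← mob_mul g⁻¹ g hw]
      simp [mob, den]

theorem quasiMeasurePreserving_mob (g : SL(2, ℂ)) :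
    Measure.QuasiMeasurePreserving (mob g) := by
  refine ⟨measurable_mob g, Measure.AbsolutelyContinuous.mk fun s hs h0 => ?_⟩
  rw [Measure.map_apply (measurable_mob g) hs]
  have h := lintegral_mob g (s.indicator 1)
  rw [lintegral_indicator_one hs, h0, lintegral_eq_zero_iff] at h
  · rw [measure_eq_zero_iff_ae_notMem]
    filter_upwards [h, ae_den_ne_zero g] with z hz hd hm
    have hm' : mob g z ∈ s := hm
    simp [hm', hd] at hz
  · have := (measurable_den g)
    have := (measurable_one.indicator hs : Measurable (s.indicator (1 : ℂ → ℝ≥0∞))).comp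
      (measurable_mob g)
    simp only [Function.comp_def] at this
    fun_prop

theorem eLpNorm_actFun (k : ℕ) (ρ : ℝ) (g : SL(2, ℂ)) (f : ℂ → ℂ) :
    eLpNorm (actFun k ρ g f) 2 volume = eLpNorm f 2 volume := by
  rw [eLpNorm_eq_lintegral_rpow_enorm_toReal two_ne_zero ENNReal.ofNat_ne_top,
    eLpNorm_eq_lintegral_rpow_enorm_toReal two_ne_zero ENNReal.ofNat_ne_top,
    ← lintegral_mob g (fun z => ‖f z‖ₑ ^ (2 : ℝ≥0∞).toReal)]
  congr 1
  refine lintegral_congr_ae ?_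
  filter_upwards [ae_den_ne_zero g] with z hz
  rw [actFun, enorm_mul, ENNReal.mul_rpow_of_nonneg _ _ (by simp)]
  congr 1
  rw [← ofReal_norm, norm_chi k ρ hz]
  simp only [ENNReal.toReal_ofNat, ENNReal.rpow_ofNat]
  rw [← ENNReal.ofReal_pow (by positivity)]
  simp

theorem memLp_actFun (k : ℕ) (ρ : ℝ) (g : SL(2, ℂ)) {f : ℂ → ℂ} (hf : MemLp f 2 volume) :
    MemLp (actFun k ρ g f) 2 volume := by
  refine ⟨?_, by rw [eLpNorm_actFun]; exact hf.2⟩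
  exact ((measurable_chi k ρ).comp (measurable_den g)).aestronglyMeasurable.mul
    (hf.1.comp_quasiMeasurePreserving (quasiMeasurePreserving_mob g))

theorem actFun_congr (k : ℕ) (ρ : ℝ) (g : SL(2, ℂ)) {f f' : ℂ → ℂ} (h : f =ᵐ[volume] f') :
    actFun k ρ g f =ᵐ[volume] actFun k ρ g f' := by
  filter_upwards [(quasiMeasurePreserving_mob g).ae_eq_comp h] with z hz
  simp only [Function.comp_apply] at hz
  simp [actFun, hz]

/-- The operator of `g` in the principal series `(k, ρ)`. -/
def psOp (k : ℕ) (ρ : ℝ) (g : SL(2, ℂ)) : PSpace →ₗᵢ[ℂ] PSpace where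
  toFun f := (memLp_actFun k ρ g (Lp.memLp f)).toLp
  map_add' f f' := by
    ext1
    refine (MemLp.coeFn_toLp _).trans (((actFun_congr k ρ g (Lp.coeFn_add f f'))).trans ?_)
    refine Filter.EventuallyEq.trans ?_ (Lp.coeFn_add _ _).symm
    filter_upwards [MemLp.coeFn_toLp (memLp_actFun k ρ g (Lp.memLp f)),
      MemLp.coeFn_toLp (memLp_actFun k ρ g (Lp.memLp f'))] with z h1 h2
    simp [h1, h2, actFun, mul_add]
  map_smul' c f := by
    ext1
    refine (MemLp.coeFn_toLp _).trans (((actFun_congr k ρ g (Lp.coeFn_smul c f))).trans ?_)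
    refine Filter.EventuallyEq.trans ?_ (Lp.coeFn_smul _ _).symm
    filter_upwards [MemLp.coeFn_toLp (memLp_actFun k ρ g (Lp.memLp f))] with z h1
    simp [h1, actFun]
    ring
  norm_map' f := by
    simp only [LinearMap.coe_mk, AddHom.coe_mk]
    rw [Lp.norm_toLp, eLpNorm_actFun, Lp.norm_def]

theorem psOp_coeFn (k : ℕ) (ρ : ℝ) (g : SL(2, ℂ)) (f : PSpace) :
    psOp k ρ g f =ᵐ[volume] actFun k ρ g f :=
  MemLp.coeFn_toLp (memLp_actFun k ρ g (Lp.memLp f))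

theorem psOp_one (k : ℕ) (ρ : ℝ) (f : PSpace) : psOp k ρ 1 f = f := by
  ext1
  filter_upwards [psOp_coeFn k ρ 1 f] with z h
  simp [h, actFun, den, mob, chi]

theorem psOp_mul (k : ℕ) (ρ : ℝ) (g h : SL(2, ℂ)) (f : PSpace) :
    psOp k ρ (g * h) f = psOp k ρ g (psOp k ρ h f) := by
  ext1
  filter_upwards [psOp_coeFn k ρ (g * h) f, psOp_coeFn k ρ g (psOp k ρ h f),
    actFun_congr k ρ g (psOp_coeFn k ρ h f), ae_den_ne_zero g] with z h1 h2 h3 hz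
  rw [h1, h2, h3]
  simp only [actFun, den_mul g h hz, mob_mul g h hz, chi_mul, mul_assoc]

/-- The principal series unitary representation `D^{(k, ρ)}` of `SL(2, ℂ)`. -/
def principalSeries (k : ℕ) (ρ : ℝ) : SL(2, ℂ) →* (PSpace ≃ₗᵢ[ℂ] PSpace) where
  toFun g :=
    { (psOp k ρ g) with
      invFun := psOp k ρ g⁻¹
      left_inv := fun f => by
        change psOp k ρ g⁻¹ (psOp k ρ g f) = f
        rw [← psOp_mul, inv_mul_cancel, psOp_one]
      right_inv := fun f => by
        change psOp k ρ g (psOp k ρ g⁻¹ f) = f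
        rw [← psOp_mul, mul_inv_cancel, psOp_one] }
  map_one' := by
    ext1 f
    exact psOp_one k ρ f
  map_mul' g h := by
    ext1 f
    exact psOp_mul k ρ g h f

/-! ### The lowest `SU(2)`-component -/

/-- The function `(|z₁|² + |z₂|²) ^ (iρ/2 - 1 - k/2) * z₁ ^ m * z₂ ^ (k - m)` in the chart
`(z₁, z₂) = (z, 1)`. -/
def canonFun (k : ℕ) (ρ : ℝ) (m : Fin (k + 1)) (z : ℂ) : ℂ :=
  ((‖z‖ ^ 2 + 1 : ℝ) : ℂ) ^ (I * ρ / 2 - 1 - k / 2) * z ^ (m : ℕ)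

theorem memLp_canonFun (k : ℕ) (ρ : ℝ) (m : Fin (k + 1)) :
    MemLp (canonFun k ρ m) 2 volume := by
  have hpos : ∀ z : ℂ, 0 < ‖z‖ ^ 2 + 1 := fun z => by positivity
  have hmeas : AEStronglyMeasurable (canonFun k ρ m) volume := by
    refine Measurable.aestronglyMeasurable ?_
    unfold canonFun
    fun_prop
  rw [memLp_two_iff_integrable_sq_norm hmeas]
  have hint : Integrable (fun z : ℂ => ((1 : ℝ) + ‖z‖ ^ 2) ^ (-(4 : ℝ) / 2)) volume :=
    integrable_rpow_neg_one_add_norm_sq (by rw [Complex.finrank_real_complex]; norm_num)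
  refine hint.mono' (hmeas.norm.pow 2) (Filter.Eventually.of_forall fun z => ?_)
  have hN : 1 ≤ ‖z‖ ^ 2 + 1 := by nlinarith [sq_nonneg ‖z‖]
  have hre : (I * (ρ : ℂ) / 2 - 1 - k / 2).re = -1 - k / 2 := by
    simp
  rw [canonFun, norm_mul, norm_cpow_eq_rpow_re_of_pos (hpos z), hre, norm_pow z,
    mul_pow, ← Real.rpow_mul_natCast (hpos z).le, ← pow_mul ‖z‖,
    mul_comm (m : ℕ) 2, pow_mul, add_comm (1 : ℝ)]
  have hm : (‖z‖ ^ 2) ^ (m : ℕ) ≤ (‖z‖ ^ 2 + 1) ^ (k : ℝ) := by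
    rw [Real.rpow_natCast]
    calc (‖z‖ ^ 2) ^ (m : ℕ) ≤ (‖z‖ ^ 2 + 1) ^ (m : ℕ) := by gcongr; linarith
      _ ≤ (‖z‖ ^ 2 + 1) ^ k := pow_le_pow_right₀ hN (Nat.lt_succ_iff.mp m.2)
  rw [Real.norm_of_nonneg (by positivity)]
  calc _ ≤ (‖z‖ ^ 2 + 1) ^ ((-1 - (k : ℝ) / 2) * (2 : ℕ)) * (‖z‖ ^ 2 + 1) ^ (k : ℝ) :=
        mul_le_mul_of_nonneg_left hm (by positivity)
    _ = (‖z‖ ^ 2 + 1) ^ (-(4 : ℝ) / 2) := by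
      rw [← Real.rpow_add (hpos z)]
      congr 1
      push_cast
      ring

/-- The subspace `H_k` of `H_{(k, ρ)}` carrying the spin-`k/2` representation of `SU(2)`: the
functions `(|z₁|² + |z₂|²) ^ (iρ/2 - 1 - k/2) * p (z₁, z₂)` with `p` a homogeneous polynomial of
degree `k`. -/
def spinSubspace (k : ℕ) (ρ : ℝ) : Submodule ℂ PSpace :=
  Submodule.span ℂ (Set.range fun m : Fin (k + 1) => (memLp_canonFun k ρ m).toLp)

instance (k : ℕ) (ρ : ℝ) : FiniteDimensional ℂ (spinSubspace k ρ) :=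
  FiniteDimensional.span_of_finite ℂ (Set.finite_range _)

/-- `SU(2)` acts on `H_k` by linear substitution in the homogeneous polynomial, which is the
spin-`k/2` representation. -/
theorem actFun_canonFun (k : ℕ) (ρ : ℝ) (u : SL(2, ℂ))
    (hu : (u : Matrix (Fin 2) (Fin 2) ℂ) ∈ Matrix.specialUnitaryGroup (Fin 2) ℂ)
    (m : Fin (k + 1)) {z : ℂ} (hz : den u z ≠ 0) :
    actFun k ρ u (canonFun k ρ m) z =
      ((‖z‖ ^ 2 + 1 : ℝ) : ℂ) ^ (I * ρ / 2 - 1 - k / 2) *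
        ((u 0 0 * z + u 1 0) ^ (m : ℕ) * (u 0 1 * z + u 1 1) ^ (k - (m : ℕ))) := by
  have hw : 0 < ‖den u z‖ := norm_pos_iff.mpr hz
  have hN : ‖den u z‖ ^ 2 * (‖mob u z‖ ^ 2 + 1) = ‖z‖ ^ 2 + 1 := by
    have h1 : ‖den u z‖ ^ 2 * (‖mob u z‖ ^ 2 + 1) =
        ‖u 0 0 * z + u 1 0‖ ^ 2 + ‖u 0 1 * z + u 1 1‖ ^ 2 := by
      have : ‖mob u z‖ = ‖u 0 0 * z + u 1 0‖ / ‖den u z‖ := norm_div _ _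
      rw [this, div_pow, mul_add, mul_div_cancel₀ _ (by positivity), mul_one]
      rfl
    rw [h1]
    have hU := Matrix.mem_unitaryGroup_iff.mp
      (Matrix.specialUnitaryGroup_le_unitaryGroup hu)
    have e00 := congrFun (congrFun hU 0) 0
    have e01 := congrFun (congrFun hU 0) 1
    have e10 := congrFun (congrFun hU 1) 0
    have e11 := congrFun (congrFun hU 1) 1
    simp only [Matrix.mul_apply, Fin.sum_univ_two, Matrix.star_apply, Matrix.one_apply_eq,
      RCLike.star_def, Matrix.one_apply_ne (show (0 : Fin 2) ≠ 1 by decide),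
      Matrix.one_apply_ne (show (1 : Fin 2) ≠ 0 by decide)] at e00 e01 e10 e11
    apply ofReal_injective
    push_cast
    simp only [← mul_conj', map_add, map_mul]
    linear_combination z * (starRingEnd ℂ) z * e00 + z * e01 + (starRingEnd ℂ) z * e10 + e11
  have hs : (‖den u z‖ : ℂ) ^ (I * (ρ : ℂ) - 2 - k) =
      ((‖den u z‖ ^ 2 : ℝ) : ℂ) ^ (I * (ρ : ℂ) / 2 - 1 - k / 2) := by
    rw [show I * (ρ : ℂ) - 2 - k = (2 : ℕ) * (I * (ρ : ℂ) / 2 - 1 - k / 2) by push_cast; ring,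
      cpow_nat_mul, sq ‖den u z‖, ofReal_mul, mul_cpow_ofReal_nonneg hw.le hw.le, sq]
  have hp : (u 0 1 * z + u 1 1) ^ (k - (m : ℕ)) * (u 0 0 * z + u 1 0) ^ (m : ℕ) =
      den u z ^ k * mob u z ^ (m : ℕ) := by
    have e : den u z * mob u z = u 0 0 * z + u 1 0 := by rw [mob, mul_div_cancel₀ _ hz]
    rw [← e, mul_pow, ← mul_assoc]
    congr 1
    change den u z ^ _ * _ = _
    rw [← pow_add, Nat.sub_add_cancel (Nat.lt_succ_iff.mp m.2)]
  rw [actFun, chi, canonFun, hs, ← hN, ofReal_mul,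
    mul_cpow_ofReal_nonneg (by positivity) (by positivity), mul_comm (_ ^ (m : ℕ)), hp]
  ring

/-- The orthogonal projection `P_k` of `H_{(k, ρ)}` onto `H_k`. -/
def projK (k : ℕ) (ρ : ℝ) : PSpace →L[ℂ] PSpace := (spinSubspace k ρ).starProjection

/-! ### The trace and the face weight -/

/-- The trace `∑ᵢ ⟨bᵢ, A bᵢ⟩` of an operator with respect to a Hilbert basis. -/
def traceIn {ι : Type*} (b : HilbertBasis ι ℂ PSpace) (A : PSpace →L[ℂ] PSpace) : ℂ :=
  ∑' i, ⟪b i, A (b i)⟫_ℂ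

/-- The trace of an operator on `H_{(k, ρ)}`, in some Hilbert basis. -/
def hilbertTrace (A : PSpace →L[ℂ] PSpace) : ℂ :=
  traceIn (exists_hilbertBasis ℂ PSpace).choose_spec.choose A

theorem hasSum_trace_finiteRank {ι : Type*} (b : HilbertBasis ι ℂ PSpace)
    (A : PSpace →L[ℂ] PSpace) [FiniteDimensional ℂ A.range] :
    HasSum (fun i => ⟪b i, A (b i)⟫_ℂ)
      (∑ j, ⟪(stdOrthonormalBasis ℂ A.range j : PSpace),
        A (stdOrthonormalBasis ℂ A.range j)⟫_ℂ) := by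
  have h := hasSum_sum (s := Finset.univ) fun j _ => b.hasSum_inner_mul_inner
    (ContinuousLinearMap.adjoint A (stdOrthonormalBasis ℂ A.range j))
    (stdOrthonormalBasis ℂ A.range j : PSpace)
  simp only [ContinuousLinearMap.adjoint_inner_left] at h
  refine (congrArg (HasSum · _) (funext fun i => ?_)).mpr h
  have hx := (stdOrthonormalBasis ℂ A.range).sum_repr' ⟨A (b i), ⟨b i, rfl⟩⟩
  have hx' := congrArg (fun x : A.range => ⟪b i, (x : PSpace)⟫_ℂ) hx
  simp only [Submodule.coe_sum, Submodule.coe_smul, inner_sum, inner_smul_right,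
    Submodule.coe_inner] at hx'
  exact hx'.symm

/-- For a finite-rank operator the sum defining the trace converges in every Hilbert basis, to a
value that does not depend on the basis. -/
theorem hasSum_hilbertTrace {ι : Type*} (b : HilbertBasis ι ℂ PSpace) (A : PSpace →L[ℂ] PSpace)
    [FiniteDimensional ℂ A.range] : HasSum (fun i => ⟪b i, A (b i)⟫_ℂ) (hilbertTrace A) := by
  rw [hilbertTrace, traceIn, (hasSum_trace_finiteRank _ A).tsum_eq]
  exact hasSum_trace_finiteRank b A

/-- The ordered product `∏_{v ∈ ∂h} P_k D^{(k, ρ)}(g_{ve}⁻¹ g_{ve'}) P_k` around a face with `n`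
vertices: `gIn i` and `gOut i` are the group variables `g_{ve}` and `g_{ve'}` at the `i`-th vertex
`v` of the boundary, `e` being the edge that enters `v` and `e'` the one that leaves it. -/
def faceOperator (k : ℕ) (ρ : ℝ) {n : ℕ} (gIn gOut : Fin n → SL(2, ℂ)) : PSpace →L[ℂ] PSpace :=
  (List.ofFn fun i => projK k ρ *
    ((principalSeries k ρ ((gIn i)⁻¹ * gOut i)).toContinuousLinearEquiv : PSpace →L[ℂ] PSpace) *
    projK k ρ).prod

/-- The weight `ζ_k = λ d_k Tr_{(k, ρ)} [∏ P_k g_{ve}⁻¹ g_{ve'} P_k]` of an internal face, with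
`d_k = k + 1` and `ρ = γ (k + 2)`. -/
def zeta (lam γ : ℝ) (k : ℕ) {n : ℕ} (gIn gOut : Fin n → SL(2, ℂ)) : ℂ :=
  lam * (k + 1) * hilbertTrace (faceOperator k (γ * (k + 2)) gIn gOut)

end Spinfoam

end

/-!
An operator `T` of norm at most one on a `d`-dimensional space satisfies `|Tr T| ≤ d`, with equality
only if `T` is a scalar of modulus one. The trace of the face operator is the trace on `H_k` of a
product of compressions `P_k D(g) P_k`, each of norm at most one. If that product is a scalar of
modulus one then every factor is isometric on `H_k`, and since `D(g)` is unitary this means that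
`D(g)` maps `H_k` into itself.

Up to the radial factor `(|z₁|² + |z₂|²) ^ (iρ/2 - 1 - k/2)`, an element of `H_k` is a polynomial of
degree at most `k` in the chart `(z, 1)`. The operator `D(g)` turns the argument `|z|² + 1` of that
factor into the squared norm of `(z, 1) g = (a z + c, b z + d)`, and the monomials `1` and `z ^ k`
into `(b z + d) ^ k` and `(a z + c) ^ k`. If both images lie in `H_k`, coprimality of `a z + c` and
`b z + d` shows that the quotient of the two radial factors is constant. Hence `g` rescales the norm
of `ℂ²`, and `det g = 1` gives `g ∈ SU(2)`. Finally `D(g)` is scalar on `H_k` only if the Möbius map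
of `g` is the identity, that is `g = ±1`.
-/

namespace Spinfoam

open Polynomial

section Contraction

theorem norm_list_prod_le_one {𝕜 V : Type*} [NontriviallyNormedField 𝕜]
    [SeminormedAddCommGroup V] [NormedSpace 𝕜 V] {l : List (V →L[𝕜] V)} (hl : ∀ A ∈ l, ‖A‖ ≤ 1) :
    ‖l.prod‖ ≤ 1 :=
  List.prod_induction (‖·‖ ≤ 1)
    (fun A B hA hB ↦ (norm_mul_le A B).trans (mul_le_one₀ hA (norm_nonneg B) hB))
    ContinuousLinearMap.norm_id_le hl

variable {𝕜 V : Type*} [NontriviallyNormedField 𝕜] [NormedAddCommGroup V] [NormedSpace 𝕜 V]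
  [FiniteDimensional 𝕜 V]

theorem norm_apply_of_norm_mul_apply {A B : V →L[𝕜] V} (hA : ‖A‖ ≤ 1) (hB : ‖B‖ ≤ 1)
    (hAB : ∀ x, ‖(A * B) x‖ = ‖x‖) : (∀ x, ‖A x‖ = ‖x‖) ∧ ∀ x, ‖B x‖ = ‖x‖ := by
  have hB' (x) : ‖B x‖ = ‖x‖ :=
    (B.le_of_opNorm_le hB x |>.trans_eq (one_mul _)).antisymm <|
      (hAB x).symm.trans_le (A.le_of_opNorm_le hA (B x) |>.trans_eq (one_mul _))
  have hsurj : Function.Surjective B :=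
    LinearMap.injective_iff_surjective.mp
      (LinearIsometry.injective ⟨(B : V →ₗ[𝕜] V), hB'⟩)
  refine ⟨fun y ↦ ?_, hB'⟩
  obtain ⟨x, rfl⟩ := hsurj y
  exact (hAB x).trans (hB' x).symm

theorem norm_apply_of_norm_list_prod_apply {l : List (V →L[𝕜] V)} (hl : ∀ A ∈ l, ‖A‖ ≤ 1)
    (hprod : ∀ x, ‖l.prod x‖ = ‖x‖) : ∀ A ∈ l, ∀ x, ‖A x‖ = ‖x‖ := by
  induction l with
  | nil => simp
  | cons A l ih =>
    rw [List.forall_mem_cons] at hl ⊢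
    rw [List.prod_cons] at hprod
    obtain ⟨hA, hl'⟩ := norm_apply_of_norm_mul_apply hl.1 (norm_list_prod_le_one hl.2) hprod
    exact ⟨hA, ih hl.2 hl'⟩

end Contraction

section TraceOfContraction

variable {𝕜 V : Type*} [RCLike 𝕜] [NormedAddCommGroup V] [InnerProductSpace 𝕜 V]
  [FiniteDimensional 𝕜 V]

theorem norm_trace_le_finrank_mul_norm (T : V →L[𝕜] V) :
    ‖LinearMap.trace 𝕜 V T‖ ≤ Module.finrank 𝕜 V * ‖T‖ := by
  set e := stdOrthonormalBasis 𝕜 V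
  have hterm (j) : ‖⟪e j, T (e j)⟫_𝕜‖ ≤ ‖T‖ := by
    simpa [e.norm_eq_one] using (norm_inner_le_norm (𝕜 := 𝕜) (e j) (T (e j))).trans
      (mul_le_mul_of_nonneg_left (T.le_opNorm (e j)) (norm_nonneg _))
  rw [LinearMap.trace_eq_sum_inner _ e]
  simpa using norm_sum_le_of_le Finset.univ fun j _ ↦ hterm j

theorem eq_smul_one_of_trace_eq {T : V →L[𝕜] V} (hT : ‖T‖ ≤ 1) {c : 𝕜} (hc : ‖c‖ = 1)
    (htr : LinearMap.trace 𝕜 V T = c * Module.finrank 𝕜 V) : T = c • 1 := by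
  set e := stdOrthonormalBasis 𝕜 V
  have hterm (j) : ‖T (e j) - c • e j‖ ^ 2 ≤
      2 - 2 * RCLike.re (starRingEnd 𝕜 c * ⟪e j, T (e j)⟫_𝕜) := by
    have hTe : ‖T (e j)‖ ≤ 1 := T.unit_le_opNorm _ (e.norm_eq_one j).le |>.trans hT
    rw [norm_sub_sq (𝕜 := 𝕜), norm_smul, hc, e.norm_eq_one, ← inner_re_symm, inner_smul_left]
    nlinarith [norm_nonneg (T (e j))]
  have hsum : ∑ j, ‖T (e j) - c • e j‖ ^ 2 ≤ 0 := by
    refine (Finset.sum_le_sum fun j _ ↦ hterm j).trans_eq ?_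
    have hcc : starRingEnd 𝕜 c * c = 1 := by simp [RCLike.conj_mul, hc]
    rw [Finset.sum_sub_distrib, ← Finset.mul_sum, ← map_sum, ← Finset.mul_sum,
      ← ContinuousLinearMap.coe_coe, ← LinearMap.trace_eq_sum_inner, htr, ← mul_assoc, hcc, one_mul]
    simp [mul_comm]
  have hzero (j) : T (e j) = c • e j := by
    have h := (Finset.sum_eq_zero_iff_of_nonneg fun j _ ↦ sq_nonneg _).mp
      (hsum.antisymm (Finset.sum_nonneg fun j _ ↦ sq_nonneg _)) j (Finset.mem_univ j)
    rwa [sq_eq_zero_iff, norm_eq_zero, sub_eq_zero] at h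
  refine ContinuousLinearMap.coe_injective (e.toBasis.ext fun j ↦ ?_)
  simpa using hzero j

theorem norm_trace_eq_finrank_iff {T : V →L[𝕜] V} (hT : ‖T‖ ≤ 1) :
    ‖LinearMap.trace 𝕜 V T‖ = Module.finrank 𝕜 V ↔ ∃ c : 𝕜, ‖c‖ = 1 ∧ T = c • 1 := by
  constructor
  · intro h
    obtain ⟨c, hc, htr⟩ := RCLike.exists_norm_mul_eq_self (LinearMap.trace 𝕜 V T)
    refine ⟨c, hc, eq_smul_one_of_trace_eq hT hc ?_⟩
    rw [← htr, h, RCLike.ofReal_natCast]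
  · rintro ⟨c, hc, rfl⟩
    simp [hc]

end TraceOfContraction

section Compression

theorem mapsTo_list_prod {R M : Type*} [Semiring R] [AddCommMonoid M] [Module R M]
    [TopologicalSpace M] {s : Set M} {l : List (M →L[R] M)} (hl : ∀ A ∈ l, Set.MapsTo A s s) :
    Set.MapsTo l.prod s s :=
  List.prod_induction (fun A : M →L[R] M ↦ Set.MapsTo A s s) (fun _ _ hA hB ↦ hA.comp hB)
    (Set.mapsTo_id s) hl

variable {𝕜 E : Type*} [RCLike 𝕜] [NormedAddCommGroup E] [InnerProductSpace 𝕜 E]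

section

variable (S : Submodule 𝕜 E) [S.HasOrthogonalProjection]

/-- The compression `P A|_S : S → S` of an operator `A` to the subspace `S`, with `P` the orthogonal
projection onto `S`. -/
noncomputable def compression (A : E →L[𝕜] E) : S →L[𝕜] S :=
  S.orthogonalProjectionOnto ∘L A ∘L S.subtypeL

/-- The operator on the whole space that is `T` on `S` and zero on the orthogonal complement. -/
noncomputable def extendByZero (T : S →L[𝕜] S) : E →L[𝕜] E :=
  S.subtypeL ∘L T ∘L S.orthogonalProjectionOnto

theorem extendByZero_compression (A : E →L[𝕜] E) :
    extendByZero S (compression S A) = S.starProjection * A * S.starProjection := rfl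

theorem extendByZero_mul (T T' : S →L[𝕜] S) :
    extendByZero S (T * T') = extendByZero S T * extendByZero S T' := by
  ext x
  simp [extendByZero]

theorem extendByZero_list_prod {l : List (S →L[𝕜] S)} (hl : l ≠ []) :
    extendByZero S l.prod = (l.map (extendByZero S)).prod := by
  induction l, hl using List.recNeNil with
  | singleton T => simp
  | cons T l _ ih => rw [List.prod_cons, extendByZero_mul, ih, List.map_cons, List.prod_cons]

theorem norm_compression_le (A : E →L[𝕜] E) : ‖compression S A‖ ≤ ‖A‖ :=
  ContinuousLinearMap.opNorm_le_bound _ (norm_nonneg A) fun x ↦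
    (S.norm_orthogonalProjectionOnto_apply_le (A x)).trans (A.le_opNorm x)

theorem norm_le_one_of_mem_map_compression {l : List (E →L[𝕜] E)} (hl : ∀ A ∈ l, ‖A‖ ≤ 1) :
    ∀ T ∈ l.map (compression S), ‖T‖ ≤ 1 :=
  List.forall_mem_map.mpr fun A hA ↦ (norm_compression_le S A).trans (hl A hA)

variable {S}

theorem coe_compression_apply {A : E →L[𝕜] E} {x : S} (hx : A x ∈ S) :
    (compression S A x : E) = A x :=
  S.starProjection_eq_self_iff.mpr hx

theorem apply_mem_of_norm_compression_apply {A : E →L[𝕜] E} (hA : ‖A‖ ≤ 1) {x : S}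
    (hx : ‖compression S A x‖ = ‖x‖) : A x ∈ S := by
  rw [S.mem_iff_norm_starProjection]
  refine (S.norm_starProjection_apply_le (A x)).antisymm ?_
  calc ‖A x‖ ≤ ‖x‖ := (A.le_of_opNorm_le hA x).trans_eq (one_mul _)
    _ = ‖compression S A x‖ := hx.symm

theorem compression_mul {A B : E →L[𝕜] E} (hB : Set.MapsTo B S S) :
    compression S (A * B) = compression S A * compression S B := by
  ext x
  simp only [compression, mul_apply_eq_comp, ContinuousLinearMap.comp_apply,
    Submodule.subtypeL_apply, ← Submodule.starProjection_apply,
    S.starProjection_eq_self_iff.mpr (hB x.2)]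

theorem compression_list_prod {l : List (E →L[𝕜] E)} (hl : ∀ A ∈ l, Set.MapsTo A S S) :
    compression S l.prod = (l.map (compression S)).prod := by
  induction l with
  | nil => ext x; simp [compression]
  | cons A l ih =>
    rw [List.forall_mem_cons] at hl
    rw [List.prod_cons, List.map_cons, List.prod_cons, compression_mul (mapsTo_list_prod hl.2),
      ih hl.2]

end

variable {S : Submodule 𝕜 E} [FiniteDimensional 𝕜 S]

theorem hasSum_inner_extendByZero {ι : Type*} (b : HilbertBasis ι 𝕜 E) (T : S →L[𝕜] S) :
    HasSum (fun i ↦ ⟪b i, extendByZero S T (b i)⟫_𝕜) (LinearMap.trace 𝕜 S T) := by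
  set e := stdOrthonormalBasis 𝕜 S
  have hsum := hasSum_sum (s := Finset.univ) fun j _ ↦
    b.hasSum_inner_mul_inner (ContinuousLinearMap.adjoint T (e j) : E) (e j : E)
  have hterm (i) : ⟪b i, extendByZero S T (b i)⟫_𝕜 =
      ∑ j, ⟪(ContinuousLinearMap.adjoint T (e j) : E), b i⟫_𝕜 * ⟪b i, (e j : E)⟫_𝕜 := by
    set y := S.orthogonalProjectionOnto (b i)
    calc ⟪b i, (T y : E)⟫_𝕜 = ⟪y, T y⟫_𝕜 := by simp [y]
      _ = ∑ j, ⟪y, e j⟫_𝕜 * ⟪e j, T y⟫_𝕜 := (e.sum_inner_mul_inner y (T y)).symm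
      _ = _ := by
        refine Finset.sum_congr rfl fun j _ ↦ ?_
        rw [← ContinuousLinearMap.adjoint_inner_left, mul_comm]
        simp [y]
  simp only [hterm]
  rw [LinearMap.trace_eq_sum_inner _ e]
  simpa [← Submodule.coe_inner, ContinuousLinearMap.adjoint_inner_left] using hsum

theorem mapsTo_of_norm_list_prod_compression_apply {l : List (E →L[𝕜] E)} (hl : ∀ A ∈ l, ‖A‖ ≤ 1)
    (hprod : ∀ x, ‖(l.map (compression S)).prod x‖ = ‖x‖) : ∀ A ∈ l, Set.MapsTo A S S := by
  have h := norm_apply_of_norm_list_prod_apply (norm_le_one_of_mem_map_compression S hl) hprod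
  exact fun A hA x hx ↦ apply_mem_of_norm_compression_apply (hl A hA) (x := ⟨x, hx⟩)
    (List.forall_mem_map.mp h A hA ⟨x, hx⟩)

theorem norm_trace_list_prod_compression_le {l : List (E →L[𝕜] E)} (hl : ∀ A ∈ l, ‖A‖ ≤ 1) :
    ‖LinearMap.trace 𝕜 S (l.map (compression S)).prod‖ ≤ Module.finrank 𝕜 S :=
  (norm_trace_le_finrank_mul_norm _).trans <|
    mul_le_of_le_one_right (Nat.cast_nonneg _)
      (norm_list_prod_le_one (norm_le_one_of_mem_map_compression S hl))

theorem norm_trace_list_prod_compression_eq_iff {l : List (E →L[𝕜] E)} (hl : ∀ A ∈ l, ‖A‖ ≤ 1) :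
    ‖LinearMap.trace 𝕜 S (l.map (compression S)).prod‖ = Module.finrank 𝕜 S ↔
      (∀ A ∈ l, Set.MapsTo A S S) ∧ ∃ c : 𝕜, ‖c‖ = 1 ∧ ∀ x ∈ S, l.prod x = c • x := by
  rw [norm_trace_eq_finrank_iff
    (norm_list_prod_le_one (norm_le_one_of_mem_map_compression S hl))]
  have heq {c : 𝕜} (hmaps : ∀ A ∈ l, Set.MapsTo A S S) :
      (l.map (compression S)).prod = c • 1 ↔ ∀ x ∈ S, l.prod x = c • x := by
    rw [← compression_list_prod hmaps, ContinuousLinearMap.ext_iff, Subtype.forall]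
    refine forall₂_congr fun x hx ↦ ?_
    rw [Subtype.ext_iff, coe_compression_apply (mapsTo_list_prod hmaps hx)]
    rfl
  constructor
  · rintro ⟨c, hc, hprod⟩
    have hnorm (x : S) : ‖(l.map (compression S)).prod x‖ = ‖x‖ := by
      simp [hprod, norm_smul, hc]
    have hmaps := mapsTo_of_norm_list_prod_compression_apply hl hnorm
    exact ⟨hmaps, c, hc, (heq hmaps).mp hprod⟩
  · rintro ⟨hmaps, c, hc, hprod⟩
    exact ⟨c, hc, (heq hmaps).mpr hprod⟩

end Compression

section RadialPower

/-- The complex power `x ^ (iρ/2 - 1 - k/2)`: the homogeneity factor of the elements of `H_k`, as a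
function of the squared norm `x` of the argument in `ℂ²`. -/
noncomputable def radialPow (k : ℕ) (ρ x : ℝ) : ℂ := (x : ℂ) ^ (I * ρ / 2 - 1 - k / 2)

variable (k : ℕ) (ρ : ℝ) {x y : ℝ}

theorem radialPow_ne_zero (hx : 0 < x) : radialPow k ρ x ≠ 0 := by
  rw [radialPow, Ne, cpow_eq_zero_iff, not_and_or]
  exact Or.inl (ofReal_ne_zero.mpr hx.ne')

theorem norm_radialPow_sq (hx : 0 < x) : ‖radialPow k ρ x‖ ^ 2 = (x ^ (k + 2))⁻¹ := by
  have hre : (I * (ρ : ℂ) / 2 - 1 - k / 2).re * (2 : ℕ) = -(k + 2 : ℕ) := by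
    simp only [sub_re, div_ofNat_re, re_mul_ofReal, I_re, one_re, natCast_re]
    push_cast
    ring
  rw [radialPow, norm_cpow_eq_rpow_re_of_pos hx, ← Real.rpow_mul_natCast hx.le, hre,
    Real.rpow_neg hx.le, Real.rpow_natCast]

theorem radialPow_mul (hx : 0 ≤ x) (hy : 0 ≤ y) :
    radialPow k ρ (x * y) = radialPow k ρ x * radialPow k ρ y := by
  rw [radialPow, ofReal_mul, mul_cpow_ofReal_nonneg hx hy, radialPow, radialPow]

theorem chi_eq_radialPow_mul (w : ℂ) : chi k ρ w = radialPow k ρ (‖w‖ ^ 2) * w ^ k := by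
  have hexp : I * (ρ : ℂ) - 2 - k = (2 : ℕ) * (I * ρ / 2 - 1 - k / 2) := by
    push_cast
    ring
  rw [chi, hexp, cpow_nat_mul, sq ‖w‖, radialPow_mul k ρ (norm_nonneg w) (norm_nonneg w), ← sq]
  rfl

end RadialPower

section MobiusPolynomials

/-- The numerator `a z + c` of the Möbius map of `g`, as a polynomial in `z`. -/
noncomputable def numPoly (g : SL(2, ℂ)) : ℂ[X] := C (g 0 0) * X + C (g 1 0)

/-- The denominator `b z + d` of the Möbius map of `g`, as a polynomial in `z`. -/
noncomputable def denPoly (g : SL(2, ℂ)) : ℂ[X] := C (g 0 1) * X + C (g 1 1)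

/-- The squared norm of the row vector `(z, 1) g = (a z + c, b z + d)`. -/
noncomputable def rowNormSq (g : SL(2, ℂ)) (z : ℂ) : ℝ :=
  ‖(numPoly g).eval z‖ ^ 2 + ‖(denPoly g).eval z‖ ^ 2

variable (g : SL(2, ℂ)) (z : ℂ)

theorem eval_denPoly : (denPoly g).eval z = den g z := by simp [denPoly, den]

theorem mob_eq_eval_div : mob g z = (numPoly g).eval z / (denPoly g).eval z := by
  simp [mob, numPoly, eval_denPoly]

theorem isCoprime_numPoly_denPoly : IsCoprime (numPoly g) (denPoly g) := by
  refine ⟨-C (g 0 1), C (g 0 0), ?_⟩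
  calc -C (g 0 1) * numPoly g + C (g 0 0) * denPoly g
    _ = C (g 0 0 * g 1 1 - g 0 1 * g 1 0) := by
      simp only [numPoly, denPoly, map_sub, map_mul]
      ring
    _ = 1 := by rw [det_eq, C_1]

theorem natDegree_numPoly_pos_or_natDegree_denPoly_pos :
    0 < (numPoly g).natDegree ∨ 0 < (denPoly g).natDegree := by
  have hrow : g 0 0 ≠ 0 ∨ g 0 1 ≠ 0 := by
    by_contra! h
    simpa [h.1, h.2] using det_eq g
  refine hrow.imp (fun h ↦ ?_) fun h ↦ ?_
  · rw [numPoly, natDegree_linear h]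
    exact one_pos
  · rw [denPoly, natDegree_linear h]
    exact one_pos

theorem ae_eval_denPoly_ne_zero : ∀ᵐ z : ℂ, (denPoly g).eval z ≠ 0 := by
  simpa only [eval_denPoly] using ae_den_ne_zero g

theorem denPoly_ne_zero : denPoly g ≠ 0 := by
  obtain ⟨z, hz⟩ := (ae_eval_denPoly_ne_zero g).exists
  intro h
  simp [h] at hz

theorem rowNormSq_pos : 0 < rowNormSq g z := by
  rw [rowNormSq]
  rcases eq_or_ne ((denPoly g).eval z) 0 with hden | hden
  · have hnum : (numPoly g).eval z ≠ 0 := fun hnum ↦ by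
      obtain ⟨p, q, hpq⟩ := isCoprime_numPoly_denPoly g
      simpa [hnum, hden] using congrArg (eval z) hpq
    positivity
  · positivity

variable {g z} in
theorem rowNormSq_eq_mul (hz : (denPoly g).eval z ≠ 0) :
    rowNormSq g z = ‖(denPoly g).eval z‖ ^ 2 * (‖mob g z‖ ^ 2 + 1) := by
  rw [mob_eq_eval_div, norm_div, rowNormSq]
  field_simp

variable {g} in
theorem eq_one_or_eq_neg_one_of_numPoly_eq (h : numPoly g = X * denPoly g) : g = 1 ∨ g = -1 := by
  have heval (z : ℂ) : g 0 0 * z + g 1 0 = z * (g 0 1 * z + g 1 1) := by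
    simpa [numPoly, denPoly] using congrArg (eval z) h
  have h₁₀ : g 1 0 = 0 := by linear_combination heval 0
  have h₀₁ : g 0 1 = 0 := by linear_combination h₁₀ - (heval 1 + heval (-1)) / 2
  have h₀₀ : g 0 0 = g 1 1 := by linear_combination (heval 1 - heval (-1)) / 2
  have hsq : g 1 1 ^ 2 = 1 := by linear_combination det_eq g - g 1 1 * h₀₀ + g 0 1 * h₁₀
  rcases eq_or_eq_neg_of_sq_eq_sq (g 1 1) 1 (by rw [hsq, one_pow]) with h₁₁ | h₁₁
  · left
    ext i j
    fin_cases i <;> fin_cases j <;> simp [h₀₀, h₀₁, h₁₀, h₁₁]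
  · right
    ext i j
    fin_cases i <;> fin_cases j <;> simp [h₀₀, h₀₁, h₁₀, h₁₁]

theorem ofReal_rowNormSq : (rowNormSq g z : ℂ) =
    ((g : Matrix (Fin 2) (Fin 2) ℂ) * star (g : Matrix (Fin 2) (Fin 2) ℂ)) 0 0 * (z * star z) +
      ((g : Matrix (Fin 2) (Fin 2) ℂ) * star (g : Matrix (Fin 2) (Fin 2) ℂ)) 0 1 * z +
      ((g : Matrix (Fin 2) (Fin 2) ℂ) * star (g : Matrix (Fin 2) (Fin 2) ℂ)) 1 0 * star z +
      ((g : Matrix (Fin 2) (Fin 2) ℂ) * star (g : Matrix (Fin 2) (Fin 2) ℂ)) 1 1 := by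
  simp only [rowNormSq, numPoly, denPoly, eval_add, eval_mul, eval_C, eval_X, ofReal_add,
    ofReal_pow, ← mul_conj', map_add, map_mul, Matrix.mul_apply, Fin.sum_univ_two,
    Matrix.star_apply, RCLike.star_def]
  ring

theorem rowNormSq_of_mem_specialUnitaryGroup {u : SL(2, ℂ)}
    (hu : (u : Matrix (Fin 2) (Fin 2) ℂ) ∈ Matrix.specialUnitaryGroup (Fin 2) ℂ) (z : ℂ) :
    rowNormSq u z = ‖z‖ ^ 2 + 1 := by
  have hunit := Matrix.mem_unitaryGroup_iff.mp (Matrix.specialUnitaryGroup_le_unitaryGroup hu)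
  apply ofReal_injective
  rw [ofReal_rowNormSq, hunit]
  simp [mul_conj']

theorem eq_smul_one_of_forall_quadratic_eq {M : Matrix (Fin 2) (Fin 2) ℂ} {δ : ℂ}
    (h : ∀ z, M 0 0 * (z * star z) + M 0 1 * z + M 1 0 * star z + M 1 1 = δ * (z * star z + 1)) :
    M = δ • 1 := by
  have h0 := h 0
  have h1 := h 1
  have hneg := h (-1)
  have hI := h I
  simp only [RCLike.star_def, map_zero, map_one, map_neg, conj_I] at h0 h1 hneg hI
  have hdiag : M 0 0 + M 1 1 = 2 * δ := by linear_combination (h1 + hneg) / 2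
  have hadd : M 0 1 + M 1 0 = 0 := by linear_combination (h1 - hneg) / 2
  have hsub : M 0 1 - M 1 0 = 0 := by
    linear_combination -I * (hI - hdiag) + (M 0 1 - M 1 0 - I * M 0 0 + I * δ) * I_sq
  ext i j
  fin_cases i <;> fin_cases j <;>
    simp only [Fin.zero_eta, Fin.mk_one, Matrix.smul_apply, Matrix.one_apply_eq,
      Matrix.one_apply_ne zero_ne_one, Matrix.one_apply_ne one_ne_zero, smul_eq_mul]
  · linear_combination hdiag - h0
  · linear_combination (hadd + hsub) / 2
  · linear_combination (hadd - hsub) / 2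
  · linear_combination h0

theorem mem_specialUnitaryGroup_of_rowNormSq {g : SL(2, ℂ)}
    (hg : ∀ z, rowNormSq g z = rowNormSq g 0 * (‖z‖ ^ 2 + 1)) :
    (g : Matrix (Fin 2) (Fin 2) ℂ) ∈ Matrix.specialUnitaryGroup (Fin 2) ℂ := by
  set δ := rowNormSq g 0
  set H := (g : Matrix (Fin 2) (Fin 2) ℂ) * star (g : Matrix (Fin 2) (Fin 2) ℂ) with hH
  have hscalar : H = (δ : ℂ) • 1 := eq_smul_one_of_forall_quadratic_eq fun z ↦ by
    rw [← ofReal_rowNormSq, hg z, RCLike.star_def, mul_conj']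
    push_cast
    rfl
  have hδ : δ = 1 := by
    have hdet : H.det = 1 := by
      rw [hH, Matrix.det_mul, Matrix.star_eq_conjTranspose, Matrix.det_conjTranspose, g.det_coe]
      simp
    rw [hscalar, Matrix.det_smul, Matrix.det_one, mul_one, Fintype.card_fin] at hdet
    exact (pow_eq_one_iff_of_nonneg (rowNormSq_pos g 0).le two_ne_zero).mp (mod_cast hdet)
  refine Matrix.mem_specialUnitaryGroup_iff.mpr ⟨Matrix.mem_unitaryGroup_iff.mpr ?_, g.det_coe⟩
  rw [← hH, hscalar, hδ, ofReal_one, one_smul]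

end MobiusPolynomials

section Polynomials

theorem eq_of_ae_eval_eq {p q : ℂ[X]} (h : ∀ᵐ z : ℂ, p.eval z = q.eval z) : p = q :=
  Polynomial.funext <| congrFun <|
    (Continuous.ae_eq_iff_eq volume p.continuous q.continuous).mp h

theorem exists_eq_C_mul_pow_of_mul_pow_eq {F : Type*} [Field F] {A B p q : F[X]} {k : ℕ}
    (hAB : IsCoprime A B) (hB : B ≠ 0) (hdeg : 0 < A.natDegree ∨ 0 < B.natDegree)
    (hp : p.natDegree ≤ k) (hq : q.natDegree ≤ k) (h : p * A ^ k = q * B ^ k) :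
    ∃ κ, p = C κ * B ^ k := by
  obtain ⟨r, rfl⟩ : B ^ k ∣ p := hAB.symm.pow.dvd_of_dvd_mul_right ⟨q, h.trans (mul_comm _ _)⟩
  have hqr : q = r * A ^ k := mul_right_cancel₀ (pow_ne_zero k hB) (by rw [← h]; ring)
  suffices hr : r.natDegree = 0 from
    ⟨r.coeff 0, by rw [← eq_C_of_natDegree_eq_zero hr, mul_comm]⟩
  rcases eq_or_ne r 0 with rfl | hr
  · exact natDegree_zero
  rcases hdeg with hA | hB'
  · rw [hqr, natDegree_mul hr (pow_ne_zero k (ne_zero_of_natDegree_gt hA)), natDegree_pow] at hq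
    nlinarith
  · rw [natDegree_mul (pow_ne_zero k hB) hr, natDegree_pow] at hp
    nlinarith

end Polynomials

section SpinSubspace

variable {k : ℕ} {ρ : ℝ}

variable (k ρ) in
/-- The vector of `H_k` given by the function `canonFun k ρ m`, i.e. by the monomial
`z₁ ^ m * z₂ ^ (k - m)`. -/
noncomputable def canonVec (m : Fin (k + 1)) : PSpace := (memLp_canonFun k ρ m).toLp

theorem canonVec_mem (m : Fin (k + 1)) : canonVec k ρ m ∈ spinSubspace k ρ :=
  Submodule.subset_span ⟨m, rfl⟩

theorem canonVec_coeFn (m : Fin (k + 1)) :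
    canonVec k ρ m =ᵐ[volume] fun z ↦ radialPow k ρ (‖z‖ ^ 2 + 1) * z ^ (m : ℕ) :=
  MemLp.coeFn_toLp _

theorem sum_smul_canonVec_coeFn (c : Fin (k + 1) → ℂ) :
    (∑ m, c m • canonVec k ρ m : PSpace) =ᵐ[volume]
      fun z ↦ radialPow k ρ (‖z‖ ^ 2 + 1) * (ofFn (k + 1) c).eval z := by
  have hterm : ∀ᵐ z : ℂ, ∀ m, (c m • canonVec k ρ m : PSpace) z =
      c m * (radialPow k ρ (‖z‖ ^ 2 + 1) * z ^ (m : ℕ)) := Filter.eventually_all.mpr fun m ↦ by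
    filter_upwards [Lp.coeFn_smul (c m) (canonVec k ρ m), canonVec_coeFn m] with z hsmul hvec
    rw [hsmul, Pi.smul_apply, hvec, smul_eq_mul]
  filter_upwards [Lp.coeFn_finsetSum Finset.univ fun m ↦ c m • canonVec k ρ m, hterm]
    with z hsum hz
  rw [hsum, Finset.sum_apply, ofFn_eq_sum_monomial, eval_finsetSum, Finset.mul_sum]
  refine Finset.sum_congr rfl fun m _ ↦ ?_
  rw [hz m, eval_monomial]
  ring

theorem mem_spinSubspace_iff {f : PSpace} :
    f ∈ spinSubspace k ρ ↔ ∃ p : ℂ[X], p.natDegree ≤ k ∧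
      f =ᵐ[volume] fun z ↦ radialPow k ρ (‖z‖ ^ 2 + 1) * p.eval z := by
  rw [spinSubspace, Submodule.mem_span_range_iff_exists_fun]
  constructor
  · rintro ⟨c, rfl⟩
    exact ⟨ofFn (k + 1) c, Nat.lt_succ_iff.mp (ofFn_natDegree_lt k.succ_pos c),
      sum_smul_canonVec_coeFn c⟩
  · rintro ⟨p, hp, hf⟩
    refine ⟨toFn (k + 1) p, Lp.ext ((sum_smul_canonVec_coeFn _).trans ?_)⟩
    rw [ofFn_comp_toFn_eq_id_of_natDegree_lt (Nat.lt_succ_iff.mpr hp)]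
    exact hf.symm

theorem radialPow_norm_sq_add_one_ne_zero (z : ℂ) : radialPow k ρ (‖z‖ ^ 2 + 1) ≠ 0 :=
  radialPow_ne_zero k ρ (by positivity)

variable (k ρ)

theorem linearIndependent_canonVec : LinearIndependent ℂ (canonVec k ρ) := by
  rw [Fintype.linearIndependent_iff]
  intro c hc
  suffices hzero : ofFn (k + 1) c = 0 from
    congrFun (injective_ofFn (k + 1) (hzero.trans (map_zero (ofFn (k + 1))).symm))
  refine eq_of_ae_eval_eq ?_
  have hsum := sum_smul_canonVec_coeFn (ρ := ρ) c
  rw [hc] at hsum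
  filter_upwards [hsum, Lp.coeFn_zero ℂ 2 (volume : Measure ℂ)] with z hz hzero
  rw [hzero, Pi.zero_apply] at hz
  rw [eval_zero]
  exact (mul_eq_zero.mp hz.symm).resolve_left (radialPow_norm_sq_add_one_ne_zero z)

theorem finrank_spinSubspace : Module.finrank ℂ (spinSubspace k ρ) = k + 1 :=
  (finrank_span_eq_card (linearIndependent_canonVec k ρ)).trans (Fintype.card_fin _)

variable {k}

theorem psOp_canonVec_coeFn (g : SL(2, ℂ)) (m : Fin (k + 1)) :
    psOp k ρ g (canonVec k ρ m) =ᵐ[volume] fun z ↦ radialPow k ρ (rowNormSq g z) *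
      (numPoly g ^ (m : ℕ) * denPoly g ^ (k - (m : ℕ))).eval z := by
  filter_upwards [psOp_coeFn k ρ g (canonVec k ρ m),
    actFun_congr k ρ g (canonVec_coeFn m), ae_eval_denPoly_ne_zero g] with z hpsOp hvec hz
  have hpow : (denPoly g).eval z ^ k =
      (denPoly g).eval z ^ (m : ℕ) * (denPoly g).eval z ^ (k - (m : ℕ)) := by
    rw [← pow_add, Nat.add_sub_cancel' m.is_le]
  rw [hpsOp, hvec, actFun, chi_eq_radialPow_mul, rowNormSq_eq_mul hz,
    radialPow_mul k ρ (by positivity) (by positivity), mob_eq_eval_div, ← eval_denPoly, hpow,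
    eval_mul, eval_pow, eval_pow, div_pow]
  field_simp

variable {ρ}

theorem rowNormSq_eq_of_radialPow_ae_eq {g : SL(2, ℂ)} {κ : ℂ}
    (h : ∀ᵐ z : ℂ, radialPow k ρ (rowNormSq g z) = κ * radialPow k ρ (‖z‖ ^ 2 + 1)) (z : ℂ) :
    rowNormSq g z = rowNormSq g 0 * (‖z‖ ^ 2 + 1) := by
  have hcont : Continuous (rowNormSq g) := by
    unfold rowNormSq
    fun_prop
  have hpow : (fun z : ℂ ↦ (‖z‖ ^ 2 + 1) ^ (k + 2)) =
      fun z ↦ rowNormSq g z ^ (k + 2) * ‖κ‖ ^ 2 := by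
    refine (Continuous.ae_eq_iff_eq volume (by fun_prop) (by fun_prop)).mp ?_
    filter_upwards [h] with z hz
    have hnorm := congrArg (‖·‖ ^ 2) hz
    have hpos := rowNormSq_pos g z
    rw [norm_mul, mul_pow, norm_radialPow_sq k ρ hpos, norm_radialPow_sq k ρ (by positivity)]
      at hnorm
    field_simp at hnorm
    exact hnorm
  have hzero := congrFun hpow 0
  simp only [norm_zero, ne_eq, OfNat.ofNat_ne_zero, not_false_eq_true, zero_pow, zero_add,
    one_pow] at hzero
  refine (pow_left_inj₀ (rowNormSq_pos g z).le
    (mul_nonneg (rowNormSq_pos g 0).le (by positivity)) (by omega : k + 2 ≠ 0)).mp ?_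
  rw [mul_pow, congrFun hpow z]
  linear_combination rowNormSq g z ^ (k + 2) * hzero

theorem exists_radialPow_rowNormSq_ae_eq {g : SL(2, ℂ)}
    (hg : Set.MapsTo (psOp k ρ g) (spinSubspace k ρ) (spinSubspace k ρ)) :
    ∃ κ : ℂ, ∀ᵐ z : ℂ, radialPow k ρ (rowNormSq g z) = κ * radialPow k ρ (‖z‖ ^ 2 + 1) := by
  obtain ⟨p, hp, hpg⟩ := mem_spinSubspace_iff.mp (hg (canonVec_mem 0))
  obtain ⟨q, hq, hqg⟩ := mem_spinSubspace_iff.mp (hg (canonVec_mem (Fin.last k)))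
  have hp' : ∀ᵐ z : ℂ, radialPow k ρ (rowNormSq g z) * (denPoly g).eval z ^ k =
      radialPow k ρ (‖z‖ ^ 2 + 1) * p.eval z := by
    filter_upwards [hpg, psOp_canonVec_coeFn ρ g (0 : Fin (k + 1))] with z hz hz'
    simpa [← hz] using hz'.symm
  have hq' : ∀ᵐ z : ℂ, radialPow k ρ (rowNormSq g z) * (numPoly g).eval z ^ k =
      radialPow k ρ (‖z‖ ^ 2 + 1) * q.eval z := by
    filter_upwards [hqg, psOp_canonVec_coeFn ρ g (Fin.last k)] with z hz hz'
    simpa [← hz] using hz'.symm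
  have hpq : p * numPoly g ^ k = q * denPoly g ^ k := by
    refine eq_of_ae_eval_eq ?_
    filter_upwards [hp', hq'] with z hpz hqz
    refine mul_left_cancel₀ (radialPow_norm_sq_add_one_ne_zero (k := k) (ρ := ρ) z) ?_
    rw [eval_mul, eval_mul, eval_pow, eval_pow, ← mul_assoc, ← mul_assoc, ← hpz, ← hqz]
    ring
  obtain ⟨κ, rfl⟩ := exists_eq_C_mul_pow_of_mul_pow_eq (isCoprime_numPoly_denPoly g)
    (denPoly_ne_zero g) (natDegree_numPoly_pos_or_natDegree_denPoly_pos g) hp hq hpq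
  refine ⟨κ, ?_⟩
  filter_upwards [hp', ae_eval_denPoly_ne_zero g] with z hz hden
  rw [eval_mul, eval_C, eval_pow] at hz
  exact mul_right_cancel₀ (pow_ne_zero k hden) (by rw [hz]; ring)

theorem natDegree_numPoly_pow_mul_denPoly_pow_le (g : SL(2, ℂ)) (m n : ℕ) :
    (numPoly g ^ m * denPoly g ^ n).natDegree ≤ m + n := by
  have hnum := natDegree_pow_le_of_le m (natDegree_linear_le (a := g 0 0) (b := g 1 0))
  have hden := natDegree_pow_le_of_le n (natDegree_linear_le (a := g 0 1) (b := g 1 1))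
  rw [mul_one] at hnum hden
  exact natDegree_mul_le_of_le hnum hden

variable (k ρ)

theorem mapsTo_psOp_spinSubspace_iff (g : SL(2, ℂ)) :
    Set.MapsTo (psOp k ρ g) (spinSubspace k ρ) (spinSubspace k ρ) ↔
      (g : Matrix (Fin 2) (Fin 2) ℂ) ∈ Matrix.specialUnitaryGroup (Fin 2) ℂ := by
  constructor
  · intro hg
    obtain ⟨κ, hκ⟩ := exists_radialPow_rowNormSq_ae_eq hg
    exact mem_specialUnitaryGroup_of_rowNormSq (rowNormSq_eq_of_radialPow_ae_eq hκ)
  · intro hg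
    suffices hle : spinSubspace k ρ ≤ (spinSubspace k ρ).comap (psOp k ρ g).toLinearMap from hle
    refine Submodule.span_le.mpr (Set.range_subset_iff.mpr fun m ↦ mem_spinSubspace_iff.mpr
      ⟨numPoly g ^ (m : ℕ) * denPoly g ^ (k - (m : ℕ)), ?_, ?_⟩)
    · exact (natDegree_numPoly_pow_mul_denPoly_pow_le g m (k - m)).trans_eq
        (Nat.add_sub_cancel' m.is_le)
    · filter_upwards [psOp_canonVec_coeFn ρ g m] with z hz
      exact hz.trans (by rw [rowNormSq_of_mem_specialUnitaryGroup hg])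

theorem psOp_neg_one (f : PSpace) : psOp k ρ (-1) f = (-1 : ℂ) ^ k • f := by
  ext1
  filter_upwards [psOp_coeFn k ρ (-1) f, Lp.coeFn_smul ((-1 : ℂ) ^ k) f] with z hpsOp hsmul
  rw [hpsOp, hsmul]
  simp [actFun, den, mob, chi]

variable {k ρ}

theorem numPoly_eq_X_mul_denPoly_of_psOp_eq_smul (hk : 1 ≤ k) {g : SL(2, ℂ)} {c : ℂ}
    (h : ∀ f ∈ spinSubspace k ρ, psOp k ρ g f = c • f) : numPoly g = X * denPoly g := by
  have hcanon (m : Fin (k + 1)) : ∀ᵐ z : ℂ, radialPow k ρ (rowNormSq g z) *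
      ((numPoly g).eval z ^ (m : ℕ) * (denPoly g).eval z ^ (k - (m : ℕ))) =
        c * (radialPow k ρ (‖z‖ ^ 2 + 1) * z ^ (m : ℕ)) := by
    filter_upwards [psOp_canonVec_coeFn ρ g m, canonVec_coeFn m,
      Lp.coeFn_smul c (canonVec k ρ m)] with z hpsOp hvec hsmul
    rw [h _ (canonVec_mem m), hsmul, Pi.smul_apply, hvec, smul_eq_mul] at hpsOp
    simpa only [eval_mul, eval_pow] using hpsOp.symm
  refine eq_of_ae_eval_eq ?_
  filter_upwards [hcanon 0, hcanon ⟨1, by omega⟩, ae_eval_denPoly_ne_zero g] with z h₀ h₁ hden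
  simp only [Fin.val_zero, pow_zero, one_mul, Nat.sub_zero, pow_one] at h₀ h₁
  have hne : radialPow k ρ (rowNormSq g z) * (denPoly g).eval z ^ (k - 1) ≠ 0 :=
    mul_ne_zero (radialPow_ne_zero k ρ (rowNormSq_pos g z)) (pow_ne_zero _ hden)
  have hpow : (denPoly g).eval z ^ k = (denPoly g).eval z ^ (k - 1) * (denPoly g).eval z := by
    rw [← pow_succ, Nat.sub_add_cancel hk]
  rw [hpow] at h₀
  rw [eval_mul, eval_X]
  exact mul_left_cancel₀ hne (by linear_combination h₁ - z * h₀)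

theorem exists_psOp_eq_smul_iff (hk : 1 ≤ k) {g : SL(2, ℂ)} :
    (∃ c : ℂ, ‖c‖ = 1 ∧ ∀ f ∈ spinSubspace k ρ, psOp k ρ g f = c • f) ↔ g = 1 ∨ g = -1 := by
  constructor
  · rintro ⟨c, -, h⟩
    exact eq_one_or_eq_neg_one_of_numPoly_eq (numPoly_eq_X_mul_denPoly_of_psOp_eq_smul hk h)
  · rintro (rfl | rfl)
    · exact ⟨1, norm_one, fun f _ ↦ by rw [psOp_one, one_smul]⟩
    · exact ⟨(-1) ^ k, by simp, fun f _ ↦ psOp_neg_one k ρ f⟩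

end SpinSubspace

section FaceWeight

variable {k : ℕ} (ρ : ℝ)

theorem prod_map_psOp (gs : List (SL(2, ℂ))) :
    (gs.map fun g ↦ (psOp k ρ g).toContinuousLinearMap).prod =
      (psOp k ρ gs.prod).toContinuousLinearMap := by
  induction gs with
  | nil =>
    ext1 f
    exact (psOp_one k ρ f).symm
  | cons g gs ih =>
    ext1 f
    rw [List.map_cons, List.prod_cons, List.prod_cons, ih]
    exact (psOp_mul k ρ g gs.prod f).symm

theorem faceOperator_eq_extendByZero {n : ℕ} (hn : n ≠ 0) (gIn gOut : Fin n → SL(2, ℂ)) :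
    faceOperator k ρ gIn gOut = extendByZero (spinSubspace k ρ)
      (((List.ofFn fun i ↦ (gIn i)⁻¹ * gOut i).map fun g ↦
        (psOp k ρ g).toContinuousLinearMap).map (compression (spinSubspace k ρ))).prod := by
  rw [extendByZero_list_prod]
  · rw [List.map_ofFn, List.map_ofFn, List.map_ofFn]
    exact congrArg (fun A ↦ (List.ofFn A).prod) <|
      funext fun _ ↦ (extendByZero_compression (spinSubspace k ρ) _).symm
  · simpa using hn

theorem hilbertTrace_extendByZero {S : Submodule ℂ PSpace} [FiniteDimensional ℂ S]
    (T : S →L[ℂ] S) : hilbertTrace (extendByZero S T) = LinearMap.trace ℂ S T :=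
  (hasSum_inner_extendByZero _ T).tsum_eq

theorem norm_le_one_of_mem_map_psOp (gs : List (SL(2, ℂ))) :
    ∀ A ∈ gs.map fun g ↦ (psOp k ρ g).toContinuousLinearMap, ‖A‖ ≤ 1 :=
  List.forall_mem_map.mpr fun g _ ↦ (psOp k ρ g).norm_toContinuousLinearMap_le

variable {n : ℕ} (gIn gOut : Fin n → SL(2, ℂ))

theorem norm_hilbertTrace_faceOperator_le (hn : n ≠ 0) :
    ‖hilbertTrace (faceOperator k ρ gIn gOut)‖ ≤ k + 1 := by
  rw [faceOperator_eq_extendByZero ρ hn, hilbertTrace_extendByZero]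
  refine (norm_trace_list_prod_compression_le (norm_le_one_of_mem_map_psOp ρ _)).trans_eq ?_
  rw [finrank_spinSubspace, Nat.cast_succ]

theorem norm_hilbertTrace_faceOperator_eq_iff (hk : 1 ≤ k) (hn : n ≠ 0) :
    ‖hilbertTrace (faceOperator k ρ gIn gOut)‖ = k + 1 ↔
      (∀ i, (((gIn i)⁻¹ * gOut i : SL(2, ℂ)) : Matrix (Fin 2) (Fin 2) ℂ) ∈
          Matrix.specialUnitaryGroup (Fin 2) ℂ) ∧
        ((List.ofFn fun i ↦ (gIn i)⁻¹ * gOut i).prod = 1 ∨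
          (List.ofFn fun i ↦ (gIn i)⁻¹ * gOut i).prod = -1) := by
  have hd : (k + 1 : ℝ) = Module.finrank ℂ (spinSubspace k ρ) := by
    rw [finrank_spinSubspace, Nat.cast_succ]
  rw [faceOperator_eq_extendByZero ρ hn, hilbertTrace_extendByZero, hd,
    norm_trace_list_prod_compression_eq_iff (norm_le_one_of_mem_map_psOp ρ _), prod_map_psOp,
    List.forall_mem_map, List.forall_mem_ofFn_iff]
  exact and_congr (forall_congr' fun _ ↦ mapsTo_psOp_spinSubspace_iff k ρ _)
    (exists_psOp_eq_smul_iff hk)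

end FaceWeight

end Spinfoam

theorem mainTheorem4 (lam : ℝ) (hlam : 0 < lam) (γ : ℝ) (k : ℕ) (hk : 1 ≤ k)
    (n : ℕ) (hn : 1 ≤ n) (gIn gOut : Fin n → SL(2, ℂ)) :
    ‖Spinfoam.zeta lam γ k gIn gOut‖ ≤ lam * ((k : ℝ) + 1) ^ 2 ∧
    (‖Spinfoam.zeta lam γ k gIn gOut‖ = lam * ((k : ℝ) + 1) ^ 2 ↔
      (∀ i, (((gIn i)⁻¹ * gOut i : SL(2, ℂ)) : Matrix (Fin 2) (Fin 2) ℂ) ∈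
          Matrix.specialUnitaryGroup (Fin 2) ℂ) ∧
        ((List.ofFn fun i => (gIn i)⁻¹ * gOut i).prod = 1 ∨
          (List.ofFn fun i => (gIn i)⁻¹ * gOut i).prod = -1)) := by
  have hn' : n ≠ 0 := Nat.one_le_iff_ne_zero.mp hn
  have hpos : 0 < lam * ((k : ℝ) + 1) := by positivity
  have hcoef : ‖(lam : ℂ) * (k + 1)‖ = lam * (k + 1) := by
    rw [← Nat.cast_succ, norm_mul, norm_natCast, norm_real, Real.norm_of_nonneg hlam.le,
      Nat.cast_succ]
  rw [Spinfoam.zeta, norm_mul, hcoef, sq, ← mul_assoc, mul_right_inj' hpos.ne',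
    Spinfoam.norm_hilbertTrace_faceOperator_eq_iff _ gIn gOut hk hn']
  exact ⟨mul_le_mul_of_nonneg_left
    (Spinfoam.norm_hilbertTrace_faceOperator_le _ gIn gOut hn') hpos.le, Iff.rfl⟩
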